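/- Let $k$ be a field of characteristic $0$. For an affine group scheme $G$ over $k$, let $C(G)$ be the commuting variety (scheme) of $G$, that is, the affine $k$-scheme with functor of points $$R\longmapsto\{(a,b)\in G(R)\times G(R)\mid ab=ba\}$$ on commutative $k$-algebras $R$. Let $B_n$ be the group scheme of invertible upper triangular $n\times n$ matrices, and let $U_n\subseteq B_n$ be the subgroup scheme of those matrices all of whose diagonal entries are $1$. An affine $k$-scheme $\operatorname{Spec}A$ is called a (global) complete intersection if there is a presentation $A\cong k[x_1,\dots,x_m]/(f_1,\dots,f_r)$ with Krull dimension $\dim A=m-r$. Then $$C(U_2),\quad C(U_3),\quad C(U_4),\quad C(U_5),\quad C(B_2),\quad C(B_3)$$ are complete intersections. -/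

import Mathlib

open CategoryTheory

universe u

namespace CommVar

/-- An algebra `A` over a field `k` is a (global) complete intersection if it has a presentation
`A ≅ k[x₁, …, xₙ] / (f₁, …, f_r)` such that `dim A = n - r`, with `dim` the Krull dimension. (The
equation is written as `dim A + r = n`; the zero ring has dimension `⊥` and never satisfies it.) -/
def IsGlobalCompleteIntersection (k : Type u) [Field k] (A : Type u) [CommRing A] [Algebra k A] :
    Prop :=
  ∃ (n r : ℕ) (f : Fin r → MvPolynomial (Fin n) k),
    Nonempty (A ≃ₐ[k] (MvPolynomial (Fin n) k ⧸ Ideal.span (Set.range f))) ∧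
      ringKrullDim A + (r : WithBot ℕ∞) = (n : WithBot ℕ∞)

/-- A functor of points `X : Alg_k ⥤ Set` is a complete intersection if it is an affine scheme,
`X ≅ Hom_k(A, -)`, whose coordinate ring `A` (unique up to isomorphism, by Yoneda) is a global
complete intersection over `k`. -/
def IsCompleteIntersection {k : Type u} [Field k] (X : CommAlgCat.{u} k ⥤ Type u) : Prop :=
  ∃ A : CommAlgCat.{u} k, Nonempty (X.CorepresentableBy A) ∧ IsGlobalCompleteIntersection k A

/-- The commuting variety (scheme) `C(G)` of a group functor `G`, as a functor of points:
`R ↦ {(a, b) ∈ G(R) × G(R) | a b = b a}`. -/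
def commutingVariety {k : Type u} [Field k] (G : CommAlgCat.{u} k ⥤ GrpCat.{u}) :
    CommAlgCat.{u} k ⥤ Type u where
  obj R := {p : G.obj R × G.obj R // p.1 * p.2 = p.2 * p.1}
  map φ := TypeCat.ofHom fun p =>
    ⟨((G.map φ).hom p.1.1, (G.map φ).hom p.1.2), by rw [← map_mul, ← map_mul, p.2]⟩
  map_id R := by
    ext p <;> simp
  map_comp φ ψ := by
    ext p <;> simp

section Groups

variable (n : ℕ) (R : Type u) [CommRing R]

/-- `B_n(R)`: the upper triangular matrices in `GL_n(R)`. -/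
def borelSubgroup : Subgroup (GL (Fin n) R) where
  carrier := {M | ∀ i j : Fin n, j < i → M i j = 0}
  one_mem' := fun i j h => by simp [h.ne']
  mul_mem' := by
    intro M N hM hN i j h
    exact Matrix.BlockTriangular.mul (b := id) (M := (M : Matrix (Fin n) (Fin n) R))
      (N := (N : Matrix (Fin n) (Fin n) R)) (fun i j h => hM i j h) (fun i j h => hN i j h) h
  inv_mem' := by
    intro M hM i j h
    have := Matrix.blockTriangular_inv_of_blockTriangular (b := id)
      (M := (M : Matrix (Fin n) (Fin n) R)) (fun i j h => hM i j h)
    rw [Matrix.coe_units_inv]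
    exact this h

theorem borel_mul_diag {M N : GL (Fin n) R} (hM : M ∈ borelSubgroup n R)
    (hN : N ∈ borelSubgroup n R) (i : Fin n) : (M * N) i i = M i i * N i i := by
  rw [Units.val_mul, Matrix.mul_apply]
  refine Finset.sum_eq_single i (fun j _ hj => ?_) (by simp)
  rcases lt_or_gt_of_ne hj with h | h
  · rw [hM i j h, zero_mul]
  · rw [hN j i h, mul_zero]

/-- `U_n(R)`: the upper triangular matrices in `GL_n(R)` with all diagonal entries `1`. -/
def unipotentSubgroup : Subgroup (GL (Fin n) R) where
  carrier := {M | (∀ i j : Fin n, j < i → M i j = 0) ∧ ∀ i : Fin n, M i i = 1}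
  one_mem' := ⟨(borelSubgroup n R).one_mem', fun i => by simp⟩
  mul_mem' := by
    intro M N hM hN
    refine ⟨(borelSubgroup n R).mul_mem' hM.1 hN.1, fun i => ?_⟩
    rw [borel_mul_diag n R hM.1 hN.1, hM.2, hN.2, one_mul]
  inv_mem' := by
    intro M hM
    have hI := (borelSubgroup n R).inv_mem' hM.1
    refine ⟨hI, fun i => ?_⟩
    have h := borel_mul_diag n R hM.1 hI i
    rw [hM.2, one_mul, mul_inv_cancel] at h
    simpa using h.symm

end Groups

section Functors

variable (k : Type u) [Field k] (n : ℕ)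

/-- The Borel group scheme `B_n` over `k`, as the functor `R ↦ B_n(R)`. -/
def borel : CommAlgCat.{u} k ⥤ GrpCat.{u} where
  obj R := GrpCat.of (borelSubgroup n R)
  map {R S} φ := GrpCat.ofHom
    (((Matrix.GeneralLinearGroup.map (n := Fin n) (φ.hom : R →+* S)).comp
      (borelSubgroup n R).subtype).codRestrict (borelSubgroup n S) fun M i j h => by
        simp [M.2 i j h])
  map_id R := by
    ext M
    rfl
  map_comp φ ψ := by
    ext M
    rfl

/-- The unipotent group scheme `U_n` over `k`, as the functor `R ↦ U_n(R)`. -/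
def unipotent : CommAlgCat.{u} k ⥤ GrpCat.{u} where
  obj R := GrpCat.of (unipotentSubgroup n R)
  map {R S} φ := GrpCat.ofHom
    (((Matrix.GeneralLinearGroup.map (n := Fin n) (φ.hom : R →+* S)).comp
      (unipotentSubgroup n R).subtype).codRestrict (unipotentSubgroup n S) fun M =>
        ⟨fun i j h => by simp [M.2.1 i j h], fun i => by simp [M.2.2 i]⟩)
  map_id R := by
    ext M
    rfl
  map_comp φ ψ := by
    ext M
    rfl

end Functors

end CommVar

/-! Each scheme is cut out by `r` equations in `n` variables, where `n - r` is the expected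
dimension `d`. It contains the pair `(1, 1)`, and at a maximal ideal containing the equations
Krull's height theorem gives dimension at least `n - r` (`le_ringKrullDim_quotient_add`). Only the
upper bound is specific to these groups.

For it, components need not be classified. Noether normalization together with lying over produces a
field-valued point whose residue field contains `dim A` algebraically independent elements. Hence
`dim A ≤ d` once the coordinates of every field-valued point lie in a field generated over `k` by
`d` elements (`ringKrullDim_le_of_forall_point`).

To count parameters, pair the entries of the two matrices in position `(i, j)` into a vector `p_ij`
of the plane `K × K`. The `(i, j)` entry of the commutator is then the sum over `l` of `cross p_il
p_lj`. An equation in which a vector `v` is paired with a known nonzero vector puts `v` on a line,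
so `v` costs one parameter instead of two (`IsParametrized.line`). If the coefficients vanish, the
equation may be lost, but a zero vector costs nothing, which compensates. The `isParametrized_*`
lemmas check that for these small `n` every such case stays within `d`, which is `(n - 1)(n + 2)/2`
for `U_n` and `n(n + 3)/2` for `B_n`. -/

namespace CommVar

/-! ### Dimension theory: lower bound from heights, upper bound from points -/

section Dimension

/-- Incomparability: a strict inclusion of primes stays strict after contraction along an integral
map. -/
theorem ringKrullDim_le_of_isIntegral {R S : Type*} [CommRing R] [CommRing S] [Algebra R S]
    [Algebra.IsIntegral R S] : ringKrullDim S ≤ ringKrullDim R :=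
  Order.krullDim_le_of_strictMono (PrimeSpectrum.comap (algebraMap R S)) fun p _ h =>
    have := p.isPrime
    Ideal.IsIntegral.comap_lt_comap h

open scoped IntermediateField.algebraAdjoinAdjoin in
-- The field `k(T)` is algebraic over the algebra `k[T]`, which is a quotient of a polynomial ring
-- in the elements of `T`.
theorem trdeg_adjoin_le {k K : Type u} [Field k] [Field K] [Algebra k K] (T : Set K) :
    Algebra.trdeg k (IntermediateField.adjoin k T) ≤ Cardinal.mk T := by
  have : Algebra.IsAlgebraic (Algebra.adjoin k T) (IntermediateField.adjoin k T) :=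
    IsFractionRing.comap_isAlgebraic_iff (K := IntermediateField.adjoin k T).mpr inferInstance
  have h := trdeg_add_eq k (Algebra.adjoin k T) (A := IntermediateField.adjoin k T)
  rw [trdeg_eq_zero (R := Algebra.adjoin k T), add_zero] at h
  rw [← h, Algebra.adjoin_eq_range]
  refine (trdeg_le_of_surjective _ (AlgHom.rangeRestrict_surjective _)).trans ?_
  rw [MvPolynomial.trdeg_of_isDomain, Cardinal.lift_id]

/-- A finitely generated algebra has Krull dimension at most `d` as soon as the coordinates of each
of its field-valued points lie in a field extension of `k` generated by `d` elements. -/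
theorem ringKrullDim_le_of_forall_point {k A : Type u} [Field k] [CommRing A] [Algebra k A]
    [Nontrivial A] [Algebra.FiniteType k A] (d : ℕ)
    (h : ∀ (K : Type u) [Field K] [Algebra k K] (φ : A →ₐ[k] K),
      ∃ T : Finset K, T.card ≤ d ∧ ∀ a, φ a ∈ IntermediateField.adjoin k (T : Set K)) :
    ringKrullDim A ≤ d := by
  obtain ⟨s, g, hg, hint⟩ := exists_integral_inj_algHom_of_fg k A
  let : Algebra _ _ := g.toRingHom.toAlgebra
  have : Algebra.IsIntegral (MvPolynomial (Fin s) k) A := ⟨hint⟩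
  have hdim : ringKrullDim A ≤ s := by
    refine ringKrullDim_le_of_isIntegral.trans_eq (b := ringKrullDim (MvPolynomial (Fin s) k)) ?_
    rw [MvPolynomial.ringKrullDim_of_isNoetherianRing]
    simp
  refine hdim.trans ?_
  have : FaithfulSMul (MvPolynomial (Fin s) k) A := (faithfulSMul_iff_algebraMap_injective _ _).2 hg
  -- Since `P` meets the polynomial ring in zero, that ring embeds into `Frac (A ⧸ P)`; this field
  -- carries the point to which `h` is applied.
  obtain ⟨P, hP, hP0⟩ : ∃ P : Ideal A, P.IsPrime ∧ P.comap g.toRingHom = ⊥ := by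
    obtain ⟨⟨P, hP, hP'⟩⟩ := Ideal.nonempty_primesOver (S := A) (⊥ : Ideal (MvPolynomial (Fin s) k))
    exact ⟨P, hP, hP'.over.symm⟩
  let φ : A →ₐ[k] FractionRing (A ⧸ P) :=
    (IsScalarTower.toAlgHom k (A ⧸ P) (FractionRing (A ⧸ P))).comp (Ideal.Quotient.mkₐ k P)
  obtain ⟨T, hT, hφ⟩ := h _ φ
  let F := IntermediateField.adjoin k (T : Set (FractionRing (A ⧸ P)))
  let ψ : MvPolynomial (Fin s) k →ₐ[k] F := (φ.comp g).codRestrict F.toSubalgebra fun x => hφ _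
  have hψ : Function.Injective ψ := by
    rw [injective_iff_map_eq_zero]
    intro x hx
    have h0 : φ (g x) = 0 := congrArg Subtype.val hx
    have h1 : Ideal.Quotient.mk P (g x) = 0 :=
      IsFractionRing.injective (A ⧸ P) (FractionRing (A ⧸ P)) (h0.trans (map_zero _).symm)
    have h2 : x ∈ P.comap g.toRingHom := Ideal.mem_comap.2 (Ideal.Quotient.eq_zero_iff_mem.1 h1)
    rwa [hP0] at h2
  -- Compare transcendence degrees: `s` on the polynomial side, at most `T.card` for the field
  -- generated by `T`.
  have h1 := (lift_trdeg_le_of_injective ψ hψ).trans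
    (Cardinal.lift_le.2 (trdeg_adjoin_le (k := k) (T : Set (FractionRing (A ⧸ P)))))
  rw [MvPolynomial.trdeg_of_isDomain] at h1
  simp only [Cardinal.mk_fin, Cardinal.lift_natCast, Cardinal.lift_id, SetLike.coe_sort_coe,
    Cardinal.mk_coe_finset, Nat.cast_le] at h1
  exact_mod_cast h1.trans hT

/-- Induction on the number of variables: a maximal ideal of `R[X]`, with `R` a polynomial ring over
`k`, contracts to a maximal ideal because `R` is Jacobson, and its height exceeds that of the
contraction by one. -/
theorem height_eq_of_isMaximal_mvPolynomial {k : Type*} [Field k] (n : ℕ)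
    (m : Ideal (MvPolynomial (Fin n) k)) [hm : m.IsMaximal] : m.height = n := by
  induction n with
  | zero =>
    have h := Ideal.height_le_ringKrullDim_of_ne_top hm.ne_top
    rw [MvPolynomial.ringKrullDim_of_isNoetherianRing] at h
    simp only [ringKrullDim_eq_zero_of_field, Nat.card_eq_fintype_card, Fintype.card_fin,
      Nat.cast_zero, add_zero] at h
    simpa using h
  | succ n ih =>
    let e := (MvPolynomial.finSuccEquiv k n).symm.toRingEquiv
    rw [← e.height_comap m]
    have : (m.comap e).IsMaximal := Ideal.comap_isMaximal_of_equiv e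
    generalize m.comap e = M at this
    rw [Polynomial.height_eq_height_add_one (M.under _) M]
    have : (M.under (MvPolynomial (Fin n) k)).IsMaximal :=
      Polynomial.isMaximal_comap_C_of_isJacobsonRing _
    rw [ih]
    simp

/-- Krull's height theorem at a maximal ideal containing all `f i`; such an ideal has height `n`. -/
theorem le_ringKrullDim_quotient_add {k : Type*} [Field k] (n r : ℕ)
    (f : Fin r → MvPolynomial (Fin n) k) (hf : Ideal.span (Set.range f) ≠ ⊤) :
    (n : WithBot ℕ∞) ≤ ringKrullDim (MvPolynomial (Fin n) k ⧸ Ideal.span (Set.range f)) + r := by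
  obtain ⟨m, hm, hfm⟩ := Ideal.exists_le_maximal _ hf
  have h := Ideal.height_le_ringKrullDim_quotient_add_encard (p := m) (Set.range f)
    (Ideal.span_le.1 hfm)
  rw [height_eq_of_isMaximal_mvPolynomial] at h
  refine h.trans ?_
  gcongr
  have : (Set.range f).encard ≤ r := by
    rw [← Set.image_univ]
    refine (Set.encard_image_le f _).trans ?_
    simp
  exact_mod_cast this

/-- The zero locus `V(f)`, with `f` a family of `r` polynomials, is a complete intersection as soon as
it has a rational point and the coordinates of each of its field-valued points lie in an extension of
`k` generated by `n - r` elements. -/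
theorem isGlobalCompleteIntersection_of_forall_point {k : Type u} [Field k] {σ ι : Type}
    [Fintype σ] [Fintype ι] (f : ι → MvPolynomial σ k) (d : ℕ)
    (hd : d + Fintype.card ι = Fintype.card σ)
    (hpt : ∃ v : σ → k, ∀ i, MvPolynomial.aeval v (f i) = 0)
    (h : ∀ (K : Type u) [Field K] [Algebra k K] (v : σ → K),
      (∀ i, MvPolynomial.aeval v (f i) = 0) →
      ∃ T : Finset K, T.card ≤ d ∧ ∀ s, v s ∈ IntermediateField.adjoin k (T : Set K)) :
    IsGlobalCompleteIntersection k (MvPolynomial σ k ⧸ Ideal.span (Set.range f)) := by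
  let e := MvPolynomial.renameEquiv k (Fintype.equivFin σ)
  let g : Fin (Fintype.card ι) → MvPolynomial (Fin (Fintype.card σ)) k :=
    fun i => e (f ((Fintype.equivFin ι).symm i))
  have hg : Ideal.span (Set.range g) = (Ideal.span (Set.range f)).map (e : _ →+* _) := by
    rw [Ideal.map_span, ← Set.range_comp]
    exact congrArg _ ((Fintype.equivFin ι).symm.surjective.range_comp (fun i => e (f i)))
  let E := Ideal.quotientEquivAlg _ _ e hg
  refine ⟨_, _, g, ⟨E⟩, ?_⟩
  obtain ⟨v, hv⟩ := hpt
  -- Evaluation at the rational point kills the ideal but not `1`.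
  have hne : Ideal.span (Set.range f) ≠ ⊤ := by
    intro htop
    have hle : Ideal.span (Set.range f) ≤ RingHom.ker (MvPolynomial.aeval (R := k) v) := by
      rw [Ideal.span_le]
      rintro _ ⟨i, rfl⟩
      exact hv i
    rw [htop] at hle
    exact RingHom.ker_ne_top _ (top_le_iff.1 hle)
  have hne' : Ideal.span (Set.range g) ≠ ⊤ := by
    intro htop
    have : Subsingleton (MvPolynomial σ k ⧸ Ideal.span (Set.range f)) :=
      E.toEquiv.subsingleton_congr.2 (Ideal.Quotient.subsingleton_iff.2 htop)
    exact hne (Ideal.Quotient.subsingleton_iff.1 this)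
  have : Nontrivial (MvPolynomial σ k ⧸ Ideal.span (Set.range f)) :=
    Ideal.Quotient.nontrivial_iff.2 hne
  refine le_antisymm ?_ ?_
  · rw [← hd, Nat.cast_add]
    gcongr
    refine ringKrullDim_le_of_forall_point (k := k) d fun K _ _ φ => ?_
    let q := Ideal.Quotient.mkₐ k (Ideal.span (Set.range f))
    -- A homomorphism out of the quotient is evaluation at the images of the variables, so it is a
    -- zero of `f` and `h` applies.
    have hφ : φ.comp q = MvPolynomial.aeval fun s => φ (q (MvPolynomial.X s)) :=
      MvPolynomial.algHom_ext (fun s => by simp)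
    obtain ⟨T, hT, hmem⟩ := h K (fun s => φ (q (MvPolynomial.X s))) fun i => by
      rw [← hφ]
      have : q (f i) = 0 := Ideal.Quotient.eq_zero_iff_mem.2 (Ideal.subset_span ⟨i, rfl⟩)
      simp [this]
    refine ⟨T, hT, fun a => ?_⟩
    obtain ⟨p, rfl⟩ := Ideal.Quotient.mkₐ_surjective k _ a
    change (φ.comp q) p ∈ _
    rw [hφ]
    have h1 : MvPolynomial.aeval (fun s => φ (q (MvPolynomial.X s))) p ∈
        Algebra.adjoin k (Set.range fun s => φ (q (MvPolynomial.X s))) := by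
      rw [Algebra.adjoin_range_eq_range_aeval]
      exact ⟨p, rfl⟩
    refine Algebra.adjoin_le (S := (IntermediateField.adjoin k (T : Set K)).toSubalgebra) ?_ h1
    rintro _ ⟨s, rfl⟩
    exact hmem s
  · rw [ringKrullDim_eq_of_ringEquiv E.toRingEquiv]
    exact le_ringKrullDim_quotient_add _ _ g hne'

/-- A functor whose points are the zero locus `V(f)` of `r` polynomials in `n` variables is a complete
intersection as soon as it has a rational point and the coordinates of each of its field-valued points
lie in an extension of `k` generated by `n - r` elements. -/
theorem isCompleteIntersection_of_forall_point {k : Type u} [Field k] {σ ι : Type}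
    [Fintype σ] [Fintype ι] (X : CommAlgCat.{u} k ⥤ Type u) (f : ι → MvPolynomial σ k) (d : ℕ)
    (e : ∀ R : CommAlgCat.{u} k, {v : σ → R // ∀ i, MvPolynomial.aeval v (f i) = 0} ≃ X.obj R)
    (he : ∀ (R S : CommAlgCat.{u} k) (φ : R ⟶ S) v w, (∀ s, w.1 s = φ.hom (v.1 s)) →
      e S w = X.map φ (e R v))
    (hd : d + Fintype.card ι = Fintype.card σ)
    (hpt : Nonempty (X.obj (CommAlgCat.of k k)))
    (h : ∀ (K : Type u) [Field K] [Algebra k K] (v : σ → K),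
      (∀ i, MvPolynomial.aeval v (f i) = 0) →
      ∃ T : Finset K, T.card ≤ d ∧ ∀ s, v s ∈ IntermediateField.adjoin k (T : Set K)) :
    IsCompleteIntersection X := by
  let I := Ideal.span (Set.range f)
  refine ⟨CommAlgCat.of k (MvPolynomial σ k ⧸ I), ⟨?_⟩,
    isGlobalCompleteIntersection_of_forall_point f d hd ?_ h⟩
  -- The quotient ring corepresents the zeros of `f`, by its universal property.
  · let E (R : CommAlgCat.{u} k) : (CommAlgCat.of k (MvPolynomial σ k ⧸ I) ⟶ R) ≃
        {v : σ → R // ∀ i, MvPolynomial.aeval v (f i) = 0} :=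
      { toFun := fun φ => ⟨fun s => φ.hom (Ideal.Quotient.mkₐ k I (MvPolynomial.X s)), fun i => by
          have h1 : MvPolynomial.aeval
              (fun s => φ.hom (Ideal.Quotient.mkₐ k I (MvPolynomial.X s))) =
              φ.hom.comp (Ideal.Quotient.mkₐ k I) := MvPolynomial.algHom_ext (fun s => by simp)
          have h2 : Ideal.Quotient.mkₐ k I (f i) = 0 :=
            Ideal.Quotient.eq_zero_iff_mem.2 (Ideal.subset_span ⟨i, rfl⟩)
          rw [h1, AlgHom.comp_apply, h2, map_zero]⟩
        invFun := fun v => CommAlgCat.ofHom (Ideal.Quotient.liftₐ I (MvPolynomial.aeval v.1)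
          fun a ha => by
            have hle : I ≤ RingHom.ker (MvPolynomial.aeval (R := k) v.1) := by
              rw [Ideal.span_le]
              rintro _ ⟨i, rfl⟩
              exact v.2 i
            exact hle ha)
        left_inv := fun φ => by
          refine CommAlgCat.hom_ext (Ideal.Quotient.algHom_ext _ (MvPolynomial.algHom_ext ?_))
          intro s
          exact MvPolynomial.aeval_X _ s
        right_inv := fun v => by
          ext s
          exact MvPolynomial.aeval_X _ s }
    exact
      { homEquiv := fun {R} => (E R).trans (e R)
        homEquiv_comp := fun {R S} g φ => he R S g _ _ fun s => rfl }
  · obtain ⟨x⟩ := hpt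
    exact ⟨_, ((e _).symm x).2⟩

end Dimension

/-! ### Equations of the commuting variety of an affine group -/

section Commuting

open MvPolynomial

/-- The relations `g` of `G` are imposed once on each matrix and `c` expresses commutation, whence
the equation count in `hd`. The rational point is the pair of identities. -/
theorem isCompleteIntersection_commutingVariety {k : Type u} [Field k]
    (G : CommAlgCat.{u} k ⥤ GrpCat.{u}) {τ κ ι : Type} [Fintype τ] [Fintype κ] [Fintype ι]
    (g : κ → MvPolynomial τ k)
    (e : ∀ R : CommAlgCat.{u} k, {x : τ → R // ∀ i, aeval x (g i) = 0} ≃ G.obj R)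
    (he : ∀ (R S : CommAlgCat.{u} k) (φ : R ⟶ S) x y, (∀ s, y.1 s = φ.hom (x.1 s)) →
      e S y = G.map φ (e R x))
    (c : ι → MvPolynomial (τ ⊕ τ) k)
    (hc : ∀ (R : CommAlgCat.{u} k) x y,
      (∀ i, aeval (Sum.elim x.1 y.1) (c i) = 0) ↔ e R x * e R y = e R y * e R x)
    (d : ℕ) (hd : d + (2 * Fintype.card κ + Fintype.card ι) = 2 * Fintype.card τ)
    (h : ∀ (K : Type u) [Field K] [Algebra k K] (x y : τ → K),
      (∀ i, aeval x (g i) = 0) → (∀ i, aeval y (g i) = 0) →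
      (∀ i, aeval (Sum.elim x y) (c i) = 0) →
      ∃ T : Finset K, T.card ≤ d ∧ (∀ s, x s ∈ IntermediateField.adjoin k (T : Set K)) ∧
        ∀ s, y s ∈ IntermediateField.adjoin k (T : Set K)) :
    IsCompleteIntersection (commutingVariety G) := by
  let f : (κ ⊕ κ) ⊕ ι → MvPolynomial (τ ⊕ τ) k :=
    Sum.elim (Sum.elim (fun i => rename Sum.inl (g i)) fun i => rename Sum.inr (g i)) c
  have hf : ∀ {R : Type u} [CommRing R] [Algebra k R] (v : τ ⊕ τ → R),
      (∀ i, aeval v (f i) = 0) ↔ (∀ i, aeval (v ∘ Sum.inl) (g i) = 0) ∧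
        (∀ i, aeval (v ∘ Sum.inr) (g i) = 0) ∧
        ∀ i, aeval (Sum.elim (v ∘ Sum.inl) (v ∘ Sum.inr)) (c i) = 0 := by
    intro R _ _ v
    simp only [Sum.forall, f, Sum.elim_inl, Sum.elim_inr, aeval_rename, Sum.elim_comp_inl_inr,
      and_assoc]
  refine isCompleteIntersection_of_forall_point (commutingVariety G) f d (fun R =>
    { toFun := fun v => ⟨(e R ⟨v.1 ∘ Sum.inl, ((hf v.1).1 v.2).1⟩,
        e R ⟨v.1 ∘ Sum.inr, ((hf v.1).1 v.2).2.1⟩), (hc R _ _).1 ((hf v.1).1 v.2).2.2⟩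
      invFun := fun p => ⟨Sum.elim ((e R).symm p.1.1).1 ((e R).symm p.1.2).1,
        (hf _).2 ⟨((e R).symm p.1.1).2, ((e R).symm p.1.2).2, (hc R _ _).2 (by simpa using p.2)⟩⟩
      left_inv := fun v => by
        ext s
        rcases s with s | s <;> simp
      right_inv := fun p => by
        refine Subtype.ext (Prod.ext ?_ ?_)
        · exact (e R).apply_symm_apply p.1.1
        · exact (e R).apply_symm_apply p.1.2 }) ?_ ?_ ⟨⟨(1, 1), rfl⟩⟩ ?_
  · intro R S φ v w hvw
    refine Subtype.ext (Prod.ext ?_ ?_)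
    · exact he R S φ _ _ fun s => hvw (Sum.inl s)
    · exact he R S φ _ _ fun s => hvw (Sum.inr s)
  · simp only [Fintype.card_sum]
    omega
  · intro K _ _ v hv
    obtain ⟨h1, h2, h3⟩ := (hf v).1 hv
    obtain ⟨T, hT, hx, hy⟩ := h K _ _ h1 h2 h3
    exact ⟨T, hT, fun s => by rcases s with s | s; exacts [hx s, hy s]⟩

end Commuting

/-! ### Vectors in the plane and the parameters they cost -/

section Parameters

variable (k : Type*) {K : Type*} [Field k] [Field K] [Algebra k K]

/-- The determinant of two vectors in the plane. -/
def cross (p q : K × K) : K := p.1 * q.2 - p.2 * q.1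

/-- The coordinates of the points of `S` are rational functions in `d` parameters. -/
def IsParametrized (S : Set (K × K)) (d : ℕ) : Prop :=
  ∃ T : Finset K, T.card ≤ d ∧ ∀ p ∈ S, p.1 ∈ IntermediateField.adjoin k (T : Set K) ∧
    p.2 ∈ IntermediateField.adjoin k (T : Set K)

/-- The field of definition of a set of points of the plane. -/
def coordField (S : Set (K × K)) : IntermediateField k K :=
  IntermediateField.adjoin k (Prod.fst '' S ∪ Prod.snd '' S)

variable {k}

theorem cross_swap (p q : K × K) : cross p q + cross q p = 0 := by
  simp only [cross]
  ring

theorem cross_mem {F : IntermediateField k K} {p q : K × K} (hp : p.1 ∈ F ∧ p.2 ∈ F)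
    (hq : q.1 ∈ F ∧ q.2 ∈ F) : cross p q ∈ F :=
  sub_mem (mul_mem hp.1 hq.2) (mul_mem hp.2 hq.1)

theorem cross_mem_coordField {S : Set (K × K)} {p q : K × K} (hp : p ∈ S) (hq : q ∈ S) :
    cross p q ∈ coordField k S := by
  have h : ∀ r ∈ S, r.1 ∈ coordField k S ∧ r.2 ∈ coordField k S := fun r hr =>
    ⟨IntermediateField.subset_adjoin _ _ (Or.inl ⟨r, hr, rfl⟩),
      IntermediateField.subset_adjoin _ _ (Or.inr ⟨r, hr, rfl⟩)⟩
  exact cross_mem (h p hp) (h q hq)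

namespace IsParametrized

variable {S S' : Set (K × K)} {d d' : ℕ} {u v : K × K}

theorem empty : IsParametrized k (∅ : Set (K × K)) 0 :=
  ⟨∅, by simp⟩

theorem mono (h : IsParametrized k S d) (hS : S' ⊆ S) (hd : d ≤ d') : IsParametrized k S' d' :=
  let ⟨T, hT, hm⟩ := h
  ⟨T, hT.trans hd, fun p hp => hm p (hS hp)⟩

theorem add (h : IsParametrized k S d) (hu : u ∈ S) (hv : v ∈ S) :
    IsParametrized k (insert (u + v) S) d := by
  obtain ⟨T, hT, hm⟩ := h
  refine ⟨T, hT, ?_⟩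
  rintro p (rfl | hp)
  · exact ⟨add_mem (hm u hu).1 (hm v hv).1, add_mem (hm u hu).2 (hm v hv).2⟩
  · exact hm p hp

theorem neg (h : IsParametrized k S d) (hu : u ∈ S) : IsParametrized k (insert (-u) S) d := by
  obtain ⟨T, hT, hm⟩ := h
  refine ⟨T, hT, ?_⟩
  rintro p (rfl | hp)
  · exact ⟨neg_mem (hm u hu).1, neg_mem (hm u hu).2⟩
  · exact hm p hp

theorem zero (h : IsParametrized k S d) : IsParametrized k (insert 0 S) d := by
  obtain ⟨T, hT, hm⟩ := h
  refine ⟨T, hT, ?_⟩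
  rintro p (rfl | hp)
  · exact ⟨zero_mem _, zero_mem _⟩
  · exact hm p hp

/-- A point with one coordinate free and the other one determined by it. -/
theorem insert_of_mem (h : IsParametrized k S d) (x : K)
    (hv : ∀ F : IntermediateField k K, coordField k S ≤ F → x ∈ F → v.1 ∈ F ∧ v.2 ∈ F) :
    IsParametrized k (insert v S) (d + 1) := by
  classical
  obtain ⟨T, hT, hm⟩ := h
  have hle : IntermediateField.adjoin k (T : Set K) ≤
      IntermediateField.adjoin k ((insert x T : Finset K) : Set K) :=
    IntermediateField.adjoin.mono _ _ _ (by simp)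
  refine ⟨insert x T, (Finset.card_insert_le _ _).trans (by omega), ?_⟩
  rintro p (rfl | hp)
  · refine hv _ ?_ (IntermediateField.subset_adjoin _ _ (by simp))
    rw [coordField, IntermediateField.adjoin_le_iff]
    rintro _ (⟨q, hq, rfl⟩ | ⟨q, hq, rfl⟩)
    · exact hle (hm q hq).1
    · exact hle (hm q hq).2
  · exact ⟨hle (hm p hp).1, hle (hm p hp).2⟩

theorem free (h : IsParametrized k S d) (v : K × K) : IsParametrized k (insert v S) (d + 2) := by
  -- The auxiliary point `(v.1, v.1)` records the first coordinate, so that the second can be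
  -- adjoined over a field already containing it.
  have h1 : IsParametrized k (insert (v.1, v.1) S) (d + 1) :=
    h.insert_of_mem v.1 fun F _ hx => ⟨hx, hx⟩
  have h2 : IsParametrized k (insert v (insert (v.1, v.1) S)) (d + 1 + 1) :=
    h1.insert_of_mem v.2 fun F hF hx =>
      ⟨hF (IntermediateField.subset_adjoin _ _ (Or.inl ⟨(v.1, v.1), by simp, rfl⟩)), hx⟩
  exact h2.mono (Set.insert_subset_insert (Set.subset_insert _ _)) le_rfl

/-- A point of a line with given normal vector. -/
theorem line (h : IsParametrized k S d) (hu : u ∈ S) (hu0 : u ≠ 0)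
    (hc : cross u v ∈ coordField k S) : IsParametrized k (insert v S) (d + 1) := by
  have hu1 : u.1 ∈ coordField k S := IntermediateField.subset_adjoin _ _ (Or.inl ⟨u, hu, rfl⟩)
  have hu2 : u.2 ∈ coordField k S := IntermediateField.subset_adjoin _ _ (Or.inr ⟨u, hu, rfl⟩)
  -- Solve the linear equation for the coordinate of `v` whose coefficient is nonzero; the other
  -- coordinate is the new parameter.
  by_cases h1 : u.1 = 0
  · have h2 : u.2 ≠ 0 := fun h2 => hu0 (Prod.ext h1 h2)
    refine h.insert_of_mem v.2 fun F hF hx => ⟨?_, hx⟩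
    have : v.1 = (u.1 * v.2 - cross u v) / u.2 := by
      rw [cross]
      field_simp
      ring
    rw [this]
    exact div_mem (sub_mem (mul_mem (hF hu1) hx) (hF hc)) (hF hu2)
  · refine h.insert_of_mem v.1 fun F hF hx => ⟨hx, ?_⟩
    have : v.2 = (cross u v + u.2 * v.1) / u.1 := by
      rw [cross]
      field_simp
      ring
    rw [this]
    exact div_mem (add_mem (hF hc) (mul_mem (hF hu2) hx)) (hF hu1)

theorem parallel (h : IsParametrized k S d) (hu : u ∈ S) (hu0 : u ≠ 0) (hc : cross u v = 0) :
    IsParametrized k (insert v S) (d + 1) :=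
  h.line hu hu0 (hc ▸ zero_mem _)

end IsParametrized

end Parameters

/-! ### Parameter counts for the systems of commutator equations -/

section Counting

variable {k K : Type*} [Field k] [Field K] [Algebra k K]

theorem cross_comm_eq_zero {p q : K × K} (h : cross p q = 0) : cross q p = 0 := by
  linear_combination cross_swap p q - h

/-- In the unipotent counts `u`, `v`, `w`, `z` are the entry pairs on successive superdiagonals. The
corner pair occurs in no equation and always costs two. -/
theorem isParametrized_unipotent_three {u₁ u₂ w : K × K} (h : cross u₁ u₂ = 0) :
    IsParametrized k {u₁, u₂, w} 5 := by
  by_cases h₁ : u₁ = 0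
  · subst h₁
    exact ((IsParametrized.empty.zero.free u₂).free w).mono (by simp [Set.insert_subset_iff]) (by norm_num)
  · exact (((IsParametrized.empty.free u₁).parallel (by simp) h₁ h).free w).mono
      (by simp [Set.insert_subset_iff]) (by norm_num)

/-- The `u`'s cost four, whether `u₂` vanishes or not. If `u₁` or `u₃` is nonzero, `h₃` confines
`v₂` or `v₁` to a line, giving `4 + 2 + 1`; if both vanish, `u₂`, `v₁`, `v₂` cost at most six. -/
theorem isParametrized_unipotent_four {u₁ u₂ u₃ v₁ v₂ w : K × K}
    (h₁ : cross u₁ u₂ = 0) (h₂ : cross u₂ u₃ = 0) (h₃ : cross u₁ v₂ + cross v₁ u₃ = 0) :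
    IsParametrized k {u₁, u₂, u₃, v₁, v₂, w} 9 := by
  suffices IsParametrized k {u₁, u₂, u₃, v₁, v₂} 7 from (this.free w).mono (by simp [Set.insert_subset_iff]) le_rfl
  have hu : IsParametrized k {u₁, u₂, u₃} 4 := by
    by_cases h0 : u₂ = 0
    · subst h0
      exact ((IsParametrized.empty.zero.free u₁).free u₃).mono (by simp [Set.insert_subset_iff]) (by norm_num)
    · exact (((IsParametrized.empty.free u₂).parallel (by simp) h0
        (cross_comm_eq_zero h₁)).parallel (by simp) h0 h₂).mono (by simp [Set.insert_subset_iff]) (by norm_num)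
  by_cases k₁ : u₁ = 0
  · by_cases k₃ : u₃ = 0
    · subst k₁ k₃
      exact ((((IsParametrized.empty.zero).free u₂).free v₁).free v₂).mono
        (by simp [Set.insert_subset_iff]) (by norm_num)
    · exact ((hu.free v₂).line (u := u₃) (v := v₁) (by simp) k₃ (by
        rw [show cross u₃ v₁ = cross u₁ v₂ by linear_combination cross_swap v₁ u₃ - h₃]
        exact cross_mem_coordField (by simp) (by simp))).mono (by simp [Set.insert_subset_iff]) (by norm_num)
  · exact ((hu.free v₁).line (u := u₁) (v := v₂) (by simp) k₁ (by
      rw [show cross u₁ v₂ = -cross v₁ u₃ by linear_combination h₃]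
      exact neg_mem (cross_mem_coordField (by simp) (by simp)))).mono (by simp [Set.insert_subset_iff]) (by norm_num)

/-- As `u₁` is nonzero, `h₆` confines `w₂` to a line, so `w₁`, `w₂` cost three and nine parameters
are left for the `u`'s and `v`'s. -/
theorem isParametrized_unipotent_five_of_ne_zero {u₁ u₂ u₃ u₄ v₁ v₂ v₃ w₁ w₂ : K × K}
    (h₁ : cross u₁ u₂ = 0) (h₂ : cross u₂ u₃ = 0) (h₃ : cross u₃ u₄ = 0)
    (h₄ : cross u₁ v₂ + cross v₁ u₃ = 0) (h₅ : cross u₂ v₃ + cross v₂ u₄ = 0)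
    (h₆ : cross u₁ w₂ + cross v₁ v₃ + cross w₁ u₄ = 0) (k₁ : u₁ ≠ 0) :
    IsParametrized k {u₁, u₂, u₃, u₄, v₁, v₂, v₃, w₁, w₂} 12 := by
  suffices IsParametrized k {u₁, u₂, u₃, u₄, v₁, v₂, v₃} 9 from
    ((this.free w₁).line (u := u₁) (v := w₂) (by simp) k₁ (by
      rw [show cross u₁ w₂ = -(cross v₁ v₃ + cross w₁ u₄) by linear_combination h₆]
      exact neg_mem (add_mem (cross_mem_coordField (by simp) (by simp))
        (cross_mem_coordField (by simp) (by simp))))).mono (by simp [Set.insert_subset_iff]) le_rfl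
  have hv₂ : cross u₁ v₂ = -cross v₁ u₃ := by linear_combination h₄
  by_cases k₂ : u₂ = 0
  · by_cases k₃ : u₃ = 0
    · rw [k₃, show cross v₁ 0 = 0 by simp [cross], neg_zero] at hv₂
      subst k₂ k₃
      exact (((((IsParametrized.empty.zero.free u₁).free u₄).parallel (v := v₂)
        (by simp) k₁ hv₂).free v₁).free v₃).mono (by simp [Set.insert_subset_iff]) le_rfl
    · by_cases k₄ : u₄ = 0
      · subst k₂ k₄
        exact (((((IsParametrized.empty.zero.free u₁).free u₃).free v₁).line (u := u₁) (v := v₂)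
          (by simp) k₁ (by
            rw [hv₂]
            exact neg_mem (cross_mem_coordField (by simp) (by simp)))).free v₃).mono
          (by simp [Set.insert_subset_iff]) le_rfl
      -- Here `h₅` already makes `v₂` parallel to `u₄`, so `h₄` is spent on `v₁`, whose coefficient
      -- `u₃` is nonzero.
      · rw [k₂, show cross 0 v₃ = 0 by simp [cross], zero_add] at h₅
        subst k₂
        exact ((((((IsParametrized.empty.zero.free u₁).free u₃).parallel (v := u₄)
          (by simp) k₃ h₃).parallel (v := v₂) (by simp) k₄ (cross_comm_eq_zero h₅)).line
            (u := u₃) (v := v₁) (by simp) k₃ (by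
              rw [show cross u₃ v₁ = cross u₁ v₂ by linear_combination cross_swap v₁ u₃ - h₄]
              exact cross_mem_coordField (by simp) (by simp))).free v₃).mono (by simp [Set.insert_subset_iff]) le_rfl
  -- With `u₁` and `u₂` nonzero, `h₄` constrains `v₂` and `h₅` constrains `v₃`, for a total of `5 +
  -- 2 + 1 + 1`.
  · have hu : IsParametrized k {u₁, u₂, u₃, u₄} 5 := by
      by_cases k₃ : u₃ = 0
      · subst k₃
        exact (((IsParametrized.empty.zero.free u₁).parallel (by simp) k₁ h₁).free u₄).mono
          (by simp [Set.insert_subset_iff]) le_rfl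
      · exact ((((IsParametrized.empty.free u₁).parallel (by simp) k₁ h₁).parallel
          (by simp) k₂ h₂).parallel (by simp) k₃ h₃).mono (by simp [Set.insert_subset_iff]) le_rfl
    exact (((hu.free v₁).line (u := u₁) (v := v₂) (by simp) k₁ (by
        rw [hv₂]
        exact neg_mem (cross_mem_coordField (by simp) (by simp)))).line (u := u₂) (v := v₃)
          (by simp) k₂ (by
            rw [show cross u₂ v₃ = -cross v₂ u₄ by linear_combination h₅]
            exact neg_mem (cross_mem_coordField (by simp) (by simp)))).mono (by simp [Set.insert_subset_iff]) le_rfl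

theorem isParametrized_unipotent_five {u₁ u₂ u₃ u₄ v₁ v₂ v₃ w₁ w₂ z : K × K}
    (h₁ : cross u₁ u₂ = 0) (h₂ : cross u₂ u₃ = 0) (h₃ : cross u₃ u₄ = 0)
    (h₄ : cross u₁ v₂ + cross v₁ u₃ = 0) (h₅ : cross u₂ v₃ + cross v₂ u₄ = 0)
    (h₆ : cross u₁ w₂ + cross v₁ v₃ + cross w₁ u₄ = 0) :
    IsParametrized k {u₁, u₂, u₃, u₄, v₁, v₂, v₃, w₁, w₂, z} 14 := by
  suffices IsParametrized k {u₁, u₂, u₃, u₄, v₁, v₂, v₃, w₁, w₂} 12 from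
    (this.free z).mono (by simp [Set.insert_subset_iff]) le_rfl
  by_cases k₁ : u₁ = 0
  · by_cases k₄ : u₄ = 0
    · subst k₁ k₄
      have hv₁ : cross v₁ u₃ = 0 := by simpa [cross] using h₄
      have hv₃ : cross u₂ v₃ = 0 := by simpa [cross] using h₅
      -- With `u₁ = u₄ = 0` both `w`'s are free; the two vanishing vectors pay for the constraint
      -- lost on them.
      suffices IsParametrized k {0, u₂, u₃, v₁, v₂, v₃} 8 from
        ((this.free w₁).free w₂).mono (by simp [Set.insert_subset_iff]) le_rfl
      by_cases k₂ : u₂ = 0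
      · by_cases k₃ : u₃ = 0
        · subst k₂ k₃
          exact (((IsParametrized.empty.zero.free v₁).free v₂).free v₃).mono
            (by simp [Set.insert_subset_iff]) (by norm_num)
        · exact (((((IsParametrized.empty.zero.free u₃).parallel (v := u₂) (by simp) k₃
            (cross_comm_eq_zero h₂)).parallel (v := v₁) (by simp) k₃
              (cross_comm_eq_zero hv₁)).free v₂).free v₃).mono (by simp [Set.insert_subset_iff]) le_rfl
      · exact (((((IsParametrized.empty.zero.free u₂).parallel (by simp) k₂ h₂).parallel
          (by simp) k₂ hv₃).free v₁).free v₂).mono (by simp [Set.insert_subset_iff]) le_rfl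
    -- Reflection in the antidiagonal exchanges `u₁` and `u₄`; it reverses products, hence the
    -- changes of sign below.
    · refine (isParametrized_unipotent_five_of_ne_zero (k := k) (u₁ := u₄) (u₂ := u₃) (u₃ := u₂)
        (u₄ := u₁) (v₁ := v₃) (v₂ := v₂) (v₃ := v₁) (w₁ := w₂) (w₂ := w₁)
        (cross_comm_eq_zero h₃) (cross_comm_eq_zero h₂) (cross_comm_eq_zero h₁) ?_ ?_ ?_ k₄).mono
        (by simp [Set.insert_subset_iff]) le_rfl
      · linear_combination cross_swap u₄ v₂ + cross_swap v₃ u₂ - h₅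
      · linear_combination cross_swap u₃ v₁ + cross_swap v₂ u₁ - h₄
      · linear_combination cross_swap u₄ w₁ + cross_swap v₃ v₁ + cross_swap w₂ u₁ - h₆
  · exact isParametrized_unipotent_five_of_ne_zero h₁ h₂ h₃ h₄ h₅ h₆ k₁

/-- Diagonal entries enter the equations only through differences, so `t₁ - t₂` replaces `t₁` as a
coordinate. -/
theorem isParametrized_borel_two {t₁ t₂ u : K × K} (h : cross (t₁ - t₂) u = 0) :
    IsParametrized k {t₁, t₂, u} 5 := by
  suffices IsParametrized k {t₁ - t₂, t₂, u} 5 by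
    have := this.add (u := t₁ - t₂) (v := t₂) (by simp) (by simp)
    rw [sub_add_cancel] at this
    exact this.mono (by simp [Set.insert_subset_iff]) le_rfl
  by_cases h0 : t₁ - t₂ = 0
  · rw [h0]
    exact ((IsParametrized.empty.zero.free t₂).free u).mono (by simp [Set.insert_subset_iff]) (by norm_num)
  · exact (((IsParametrized.empty.free t₂).free (t₁ - t₂)).parallel (by simp) h0 h).mono
      (by simp [Set.insert_subset_iff]) le_rfl

/-- Here `p` and `q` are the successive differences of the diagonal. If `p + q` is nonzero, `h₃`
puts `v` on a line and the rest costs at most six. If `p + q = 0`, either `p = q = 0`, or `u₁` and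
`u₂` are both parallel to `p`; with `v` free, six suffice. -/
theorem isParametrized_borel_three_of_sub {p q u₁ u₂ v : K × K} (h₁ : cross p u₁ = 0)
    (h₂ : cross q u₂ = 0) (h₃ : cross (p + q) v + cross u₁ u₂ = 0) :
    IsParametrized k {p, q, u₁, u₂, v} 7 := by
  by_cases hpq : p + q = 0
  · obtain rfl : q = -p := by linear_combination hpq
    by_cases hp : p = 0
    · subst hp
      rw [neg_zero]
      exact (((IsParametrized.empty.zero.free u₁).free u₂).free v).mono (by simp [Set.insert_subset_iff]) (by norm_num)
    · have h₂' : cross p u₂ = 0 := by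
        simp only [cross, Prod.fst_neg, Prod.snd_neg] at h₂ ⊢
        linear_combination -h₂
      exact (((((IsParametrized.empty.free p).neg (u := p) (by simp)).parallel (by simp) hp
        h₁).parallel (by simp) hp h₂').free v).mono (by simp [Set.insert_subset_iff]) (by norm_num)
  · suffices IsParametrized k {p, q, u₁, u₂} 6 from
      ((this.add (u := p) (v := q) (by simp) (by simp)).line (u := p + q) (v := v) (by simp) hpq (by
        rw [show cross (p + q) v = -cross u₁ u₂ by linear_combination h₃]
        exact neg_mem (cross_mem_coordField (by simp) (by simp)))).mono (by simp [Set.insert_subset_iff]) le_rfl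
    by_cases hp : p = 0
    · by_cases hq : q = 0
      · subst hp hq
        exact ((IsParametrized.empty.zero.free u₁).free u₂).mono (by simp [Set.insert_subset_iff]) (by norm_num)
      · subst hp
        exact (((IsParametrized.empty.zero.free q).parallel (by simp) hq h₂).free u₁).mono
          (by simp [Set.insert_subset_iff]) (by norm_num)
    · by_cases hq : q = 0
      · subst hq
        exact (((IsParametrized.empty.zero.free p).parallel (by simp) hp h₁).free u₂).mono
          (by simp [Set.insert_subset_iff]) (by norm_num)
      · exact ((((IsParametrized.empty.free p).free q).parallel (by simp) hp h₁).parallel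
          (by simp) hq h₂).mono (by simp [Set.insert_subset_iff]) le_rfl

theorem isParametrized_borel_three {t₁ t₂ t₃ u₁ u₂ v : K × K} (h₁ : cross (t₁ - t₂) u₁ = 0)
    (h₂ : cross (t₂ - t₃) u₂ = 0) (h₃ : cross (t₁ - t₃) v + cross u₁ u₂ = 0) :
    IsParametrized k {t₁, t₂, t₃, u₁, u₂, v} 9 := by
  have h := (isParametrized_borel_three_of_sub (k := k) h₁ h₂ (v := v)
    (by rwa [sub_add_sub_cancel])).free t₃
  have h' := h.add (u := t₂ - t₃) (v := t₃) (by simp) (by simp)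
  rw [sub_add_cancel] at h'
  have h'' := h'.add (u := t₁ - t₂) (v := t₂) (by simp) (by simp)
  rw [sub_add_cancel] at h''
  exact h''.mono (by simp [Set.insert_subset_iff]) le_rfl

end Counting

/-! ### Coordinates and equations for `U_n` -/

section Unipotent

open MvPolynomial

/-- The positions above the diagonal. -/
abbrev StrictPos (n : ℕ) : Type := {p : Fin n × Fin n // p.1 < p.2}

/-- The positions above the first superdiagonal. -/
abbrev CommutatorPos (n : ℕ) : Type := {p : Fin n × Fin n // (p.1 : ℕ) + 1 < p.2}

variable {n : ℕ} {R S : Type*} [CommRing R] [CommRing S]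

/-- The strictly upper triangular matrix with given entries. -/
def strictUpper (x : StrictPos n → R) : Matrix (Fin n) (Fin n) R :=
  Matrix.of fun i j => if h : i < j then x ⟨(i, j), h⟩ else 0

theorem strictUpper_of_not_lt (x : StrictPos n → R) {i j : Fin n} (h : ¬ i < j) :
    strictUpper x i j = 0 := dif_neg h

theorem map_strictUpper (φ : R →+* S) (x : StrictPos n → R) :
    (strictUpper x).map φ = strictUpper (φ ∘ x) := by
  ext i j
  by_cases h : i < j <;> simp [strictUpper, h]

/-- A nonzero summand needs an index strictly between `i` and `j`. Hence the commutator gives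
equations only at `CommutatorPos`, and the count of equations is smaller than the number of
coordinates of one matrix. -/
theorem strictUpper_mul_apply (x y : StrictPos n → R) {i j : Fin n} (h : ¬ (i : ℕ) + 1 < j) :
    (strictUpper x * strictUpper y) i j = 0 := by
  rw [Matrix.mul_apply]
  refine Finset.sum_eq_zero fun l _ => ?_
  by_cases hl : i < l
  · rw [strictUpper_of_not_lt y (by omega), mul_zero]
  · rw [strictUpper_of_not_lt x hl, zero_mul]

/-- The commutator relations of the coordinates of two unitriangular matrices. -/
noncomputable def unipotentRelation (k : Type*) [Field k] (n : ℕ) (p : CommutatorPos n) :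
    MvPolynomial (StrictPos n ⊕ StrictPos n) k :=
  (strictUpper (fun s => X (Sum.inl s)) * strictUpper (fun s => X (Sum.inr s)) -
    strictUpper (fun s => X (Sum.inr s)) * strictUpper (fun s => X (Sum.inl s)) :
      Matrix (Fin n) (Fin n) _) p.1.1 p.1.2

theorem aeval_unipotentRelation {k : Type*} [Field k] [Algebra k R] (x y : StrictPos n → R)
    (p : CommutatorPos n) : aeval (Sum.elim x y) (unipotentRelation k n p) =
      (strictUpper x * strictUpper y - strictUpper y * strictUpper x) p.1.1 p.1.2 := by
  have hx : (strictUpper fun s => (X (Sum.inl s) : MvPolynomial (StrictPos n ⊕ StrictPos n) k)).map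
      (aeval (Sum.elim x y) : _ →ₐ[k] R).toRingHom = strictUpper x := by
    rw [map_strictUpper]
    congr 1
    ext s
    simp
  have hy : (strictUpper fun s => (X (Sum.inr s) : MvPolynomial (StrictPos n ⊕ StrictPos n) k)).map
      (aeval (Sum.elim x y) : _ →ₐ[k] R).toRingHom = strictUpper y := by
    rw [map_strictUpper]
    congr 1
    ext s
    simp
  rw [← hx, ← hy, ← Matrix.map_mul, ← Matrix.map_mul]
  exact map_sub (aeval (Sum.elim x y) : _ →ₐ[k] R) _ _

theorem det_one_add_strictUpper (x : StrictPos n → R) : (1 + strictUpper x).det = 1 := by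
  rw [Matrix.det_of_isUpperTriangular]
  · simp [strictUpper]
  · intro i j h
    have h' : j < i := h
    simp [strictUpper, h'.ne', h'.not_gt]

/-- The coordinates of a unitriangular matrix. -/
noncomputable def unipotentEquiv (n : ℕ) (R : Type u) [CommRing R] :
    (StrictPos n → R) ≃ unipotentSubgroup n R where
  toFun x := ⟨Matrix.GeneralLinearGroup.mk'' (1 + strictUpper x)
      (by rw [det_one_add_strictUpper]; exact isUnit_one),
    fun i j h => by
      change (1 + strictUpper x) i j = 0
      simp [strictUpper, h.ne', h.not_gt],
    fun i => by
      change (1 + strictUpper x) i i = 1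
      simp [strictUpper]⟩
  invFun M p := (M : GL (Fin n) R) p.1.1 p.1.2
  left_inv x := by
    funext p
    change (1 + strictUpper x) p.1.1 p.1.2 = _
    simp [strictUpper, p.2, p.2.ne]
  right_inv M := by
    refine Subtype.ext (Units.ext (Matrix.ext fun i j => ?_))
    change (1 + strictUpper _ : Matrix (Fin n) (Fin n) R) i j = (M : GL (Fin n) R) i j
    rcases lt_trichotomy i j with h | rfl | h
    · simp [strictUpper, h, h.ne]
    · simp [strictUpper, M.2.2 i]
    · simp [strictUpper, h.not_gt, h.ne', M.2.1 i j h]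

theorem coe_unipotentEquiv (R : Type u) [CommRing R] (x : StrictPos n → R) :
    ((unipotentEquiv n R x : GL (Fin n) R) : Matrix (Fin n) (Fin n) R) = 1 + strictUpper x := rfl

/-- The group commutation relation becomes the Lie one: `(1 + x)(1 + y) - (1 + y)(1 + x) = xy - yx`.
-/
theorem unipotentEquiv_commute_iff (R : Type u) [CommRing R] (x y : StrictPos n → R) :
    unipotentEquiv n R x * unipotentEquiv n R y = unipotentEquiv n R y * unipotentEquiv n R x ↔
      ∀ p : CommutatorPos n,
        (strictUpper x * strictUpper y - strictUpper y * strictUpper x) p.1.1 p.1.2 = 0 := by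
  have key : unipotentEquiv n R x * unipotentEquiv n R y =
      unipotentEquiv n R y * unipotentEquiv n R x ↔
      strictUpper x * strictUpper y - strictUpper y * strictUpper x = 0 := by
    rw [Subtype.ext_iff, Units.ext_iff]
    simp only [Subgroup.coe_mul, Units.val_mul, coe_unipotentEquiv]
    rw [← sub_eq_zero]
    apply Eq.congr_left
    noncomm_ring
  rw [key]
  refine ⟨fun h p => by rw [h]; rfl, fun h => Matrix.ext fun i j => ?_⟩
  by_cases hij : (i : ℕ) + 1 < j
  · exact h ⟨(i, j), hij⟩
  · simp [strictUpper_mul_apply _ _ hij]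

/-- As a scheme `U_n` is an affine space, so the group itself contributes no relation (`κ :=
Empty`). -/
theorem isCompleteIntersection_unipotent (k : Type u) [Field k] (n d : ℕ)
    (hd : d + Fintype.card (CommutatorPos n) = 2 * Fintype.card (StrictPos n))
    (h : ∀ (K : Type u) [Field K] [Algebra k K] (x y : StrictPos n → K),
      (∀ p : CommutatorPos n,
        (strictUpper x * strictUpper y - strictUpper y * strictUpper x) p.1.1 p.1.2 = 0) →
      IsParametrized k (Set.range fun s => (x s, y s)) d) :
    IsCompleteIntersection (commutingVariety (unipotent k n)) := by
  refine isCompleteIntersection_commutingVariety (κ := Empty) (unipotent k n) Empty.elim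
    (fun R => (Equiv.subtypeUnivEquiv fun _ i => i.elim).trans (unipotentEquiv n R)) ?_
    (unipotentRelation k n) ?_ d (by simpa using hd) ?_
  · intro R S φ x y hxy
    refine Subtype.ext (Units.ext (Matrix.ext fun i j => ?_))
    change (1 + strictUpper y.1) i j = φ.hom ((1 + strictUpper x.1) i j)
    rw [Matrix.add_apply, Matrix.add_apply, map_add]
    congr 1
    · by_cases hij : i = j <;> simp [Matrix.one_apply, hij]
    · by_cases hij : i < j
      · simp [strictUpper, hij, hxy]
      · simp [strictUpper, hij]
  · intro R x y
    simp only [aeval_unipotentRelation]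
    exact (unipotentEquiv_commute_iff R x.1 y.1).symm
  · intro K _ _ x y _ _ hxy
    simp only [aeval_unipotentRelation] at hxy
    obtain ⟨T, hT, hm⟩ := h K x y hxy
    exact ⟨T, hT, fun s => (hm _ ⟨s, rfl⟩).1, fun s => (hm _ ⟨s, rfl⟩).2⟩

/-- The point of the plane formed by the entries of two matrices in a given position. -/
def entryPair (x y : StrictPos n → R) (i j : Fin n) (h : i < j := by decide) : R × R :=
  (x ⟨(i, j), h⟩, y ⟨(i, j), h⟩)

/-- `U_2` is commutative: there is no equation, and `C(U_2)` is an affine plane. -/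
theorem isCompleteIntersection_unipotent_two (k : Type u) [Field k] :
    IsCompleteIntersection (commutingVariety (unipotent k 2)) := by
  refine isCompleteIntersection_unipotent k 2 2 (by decide) fun K _ _ x y _ =>
    (IsParametrized.empty.free (entryPair x y 0 1)).mono ?_ le_rfl
  rintro _ ⟨⟨⟨i, j⟩, h⟩, rfl⟩
  fin_cases i <;> fin_cases j <;> first | exact absurd h (by decide) | simp [entryPair]

theorem isCompleteIntersection_unipotent_three (k : Type u) [Field k] :
    IsCompleteIntersection (commutingVariety (unipotent k 3)) := by
  refine isCompleteIntersection_unipotent k 3 5 (by decide) fun K _ _ x y hxy =>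
    (isParametrized_unipotent_three (u₁ := entryPair x y 0 1) (u₂ := entryPair x y 1 2)
      (w := entryPair x y 0 2) ?_).mono ?_ le_rfl
  · have h := hxy ⟨(0, 2), by decide⟩
    simp [Matrix.mul_apply, Fin.sum_univ_succ, strictUpper] at h
    simp only [cross, entryPair]
    linear_combination h
  · rintro _ ⟨⟨⟨i, j⟩, h⟩, rfl⟩
    fin_cases i <;> fin_cases j <;> first | exact absurd h (by decide) | simp [entryPair]

theorem isCompleteIntersection_unipotent_four (k : Type u) [Field k] :
    IsCompleteIntersection (commutingVariety (unipotent k 4)) := by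
  refine isCompleteIntersection_unipotent k 4 9 (by decide) fun K _ _ x y hxy =>
    (isParametrized_unipotent_four (u₁ := entryPair x y 0 1) (u₂ := entryPair x y 1 2)
      (u₃ := entryPair x y 2 3) (v₁ := entryPair x y 0 2) (v₂ := entryPair x y 1 3)
      (w := entryPair x y 0 3) ?_ ?_ ?_).mono ?_ le_rfl
  · have h := hxy ⟨(0, 2), by decide⟩
    simp [Matrix.mul_apply, Fin.sum_univ_succ, strictUpper] at h
    simp only [cross, entryPair]
    linear_combination h
  · have h := hxy ⟨(1, 3), by decide⟩
    simp [Matrix.mul_apply, Fin.sum_univ_succ, strictUpper] at h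
    simp only [cross, entryPair]
    linear_combination h
  · have h := hxy ⟨(0, 3), by decide⟩
    simp [Matrix.mul_apply, Fin.sum_univ_succ, strictUpper] at h
    simp only [cross, entryPair]
    linear_combination h
  · rintro _ ⟨⟨⟨i, j⟩, h⟩, rfl⟩
    fin_cases i <;> fin_cases j <;> first | exact absurd h (by decide) | simp [entryPair]

theorem isCompleteIntersection_unipotent_five (k : Type u) [Field k] :
    IsCompleteIntersection (commutingVariety (unipotent k 5)) := by
  refine isCompleteIntersection_unipotent k 5 14 (by decide) fun K _ _ x y hxy =>
    (isParametrized_unipotent_five (u₁ := entryPair x y 0 1) (u₂ := entryPair x y 1 2)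
      (u₃ := entryPair x y 2 3) (u₄ := entryPair x y 3 4) (v₁ := entryPair x y 0 2)
      (v₂ := entryPair x y 1 3) (v₃ := entryPair x y 2 4) (w₁ := entryPair x y 0 3)
      (w₂ := entryPair x y 1 4) (z := entryPair x y 0 4) ?_ ?_ ?_ ?_ ?_ ?_).mono ?_ le_rfl
  · have h := hxy ⟨(0, 2), by decide⟩
    simp [Matrix.mul_apply, Fin.sum_univ_succ, strictUpper] at h
    simp only [cross, entryPair]
    linear_combination h
  · have h := hxy ⟨(1, 3), by decide⟩
    simp [Matrix.mul_apply, Fin.sum_univ_succ, strictUpper] at h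
    simp only [cross, entryPair]
    linear_combination h
  · have h := hxy ⟨(2, 4), by decide⟩
    simp [Matrix.mul_apply, Fin.sum_univ_succ, strictUpper] at h
    simp only [cross, entryPair]
    linear_combination h
  · have h := hxy ⟨(0, 3), by decide⟩
    simp [Matrix.mul_apply, Fin.sum_univ_succ, strictUpper] at h
    simp only [cross, entryPair]
    linear_combination h
  · have h := hxy ⟨(1, 4), by decide⟩
    simp [Matrix.mul_apply, Fin.sum_univ_succ, strictUpper] at h
    simp only [cross, entryPair]
    linear_combination h
  · have h := hxy ⟨(0, 4), by decide⟩
    simp [Matrix.mul_apply, Fin.sum_univ_succ, strictUpper] at h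
    simp only [cross, entryPair]
    linear_combination h
  · rintro _ ⟨⟨⟨i, j⟩, h⟩, rfl⟩
    fin_cases i <;> fin_cases j <;> first | exact absurd h (by decide) | simp [entryPair]

end Unipotent

/-! ### Coordinates and equations for `B_n` -/

section Borel

open MvPolynomial

/-- The positions on or above the diagonal. -/
abbrev UpperPos (n : ℕ) : Type := {p : Fin n × Fin n // p.1 ≤ p.2}

variable {n : ℕ} {R S : Type*} [CommRing R] [CommRing S]

/-- The upper triangular matrix with given entries. -/
def upper (x : UpperPos n → R) : Matrix (Fin n) (Fin n) R :=
  Matrix.of fun i j => if h : i ≤ j then x ⟨(i, j), h⟩ else 0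

theorem map_upper (φ : R →+* S) (x : UpperPos n → R) : (upper x).map φ = upper (φ ∘ x) := by
  ext i j
  by_cases h : i ≤ j <;> simp [upper, h]

theorem det_upper (x : UpperPos n → R) : (upper x).det = ∏ i, x ⟨(i, i), le_rfl⟩ := by
  rw [Matrix.det_of_isUpperTriangular]
  · simp [upper]
  · intro i j h
    have h' : j < i := h
    simp [upper, h'.not_ge]

/-- The relation expressing that the last coordinate is the inverse of the determinant. -/
noncomputable def borelRelation (k : Type*) [Field k] (n : ℕ) (_ : Unit) :
    MvPolynomial (UpperPos n ⊕ Unit) k :=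
  (∏ i, X (Sum.inl ⟨(i, i), le_rfl⟩)) * X (Sum.inr ()) - 1

theorem aeval_borelRelation {k : Type*} [Field k] [Algebra k R] (x : UpperPos n ⊕ Unit → R)
    (i : Unit) : aeval x (borelRelation k n i) = 0 ↔
      (upper (x ∘ Sum.inl)).det * x (Sum.inr ()) = 1 := by
  simp [borelRelation, det_upper, sub_eq_zero]

/-- The commutator relations of the coordinates of two upper triangular matrices. -/
noncomputable def borelCommutator (k : Type*) [Field k] (n : ℕ)
    (p : {p : Fin n × Fin n // p.1 < p.2}) :
    MvPolynomial ((UpperPos n ⊕ Unit) ⊕ (UpperPos n ⊕ Unit)) k :=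
  (upper (fun s => X (Sum.inl (Sum.inl s))) * upper (fun s => X (Sum.inr (Sum.inl s))) -
    upper (fun s => X (Sum.inr (Sum.inl s))) * upper (fun s => X (Sum.inl (Sum.inl s))) :
      Matrix (Fin n) (Fin n) _) p.1.1 p.1.2

theorem aeval_borelCommutator {k : Type*} [Field k] [Algebra k R] (x y : UpperPos n ⊕ Unit → R)
    (p : {p : Fin n × Fin n // p.1 < p.2}) :
    aeval (Sum.elim x y) (borelCommutator k n p) =
      (upper (x ∘ Sum.inl) * upper (y ∘ Sum.inl) -
        upper (y ∘ Sum.inl) * upper (x ∘ Sum.inl)) p.1.1 p.1.2 := by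
  have hx : (upper fun s => (X (Sum.inl (Sum.inl s)) :
      MvPolynomial ((UpperPos n ⊕ Unit) ⊕ (UpperPos n ⊕ Unit)) k)).map
      (aeval (Sum.elim x y) : _ →ₐ[k] R).toRingHom = upper (x ∘ Sum.inl) := by
    rw [map_upper]
    congr 1
    ext s
    simp
  have hy : (upper fun s => (X (Sum.inr (Sum.inl s)) :
      MvPolynomial ((UpperPos n ⊕ Unit) ⊕ (UpperPos n ⊕ Unit)) k)).map
      (aeval (Sum.elim x y) : _ →ₐ[k] R).toRingHom = upper (y ∘ Sum.inl) := by
    rw [map_upper]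
    congr 1
    ext s
    simp
  rw [← hx, ← hy, ← Matrix.map_mul, ← Matrix.map_mul]
  exact map_sub (aeval (Sum.elim x y) : _ →ₐ[k] R) _ _

/-- The coordinates of an invertible upper triangular matrix. -/
noncomputable def borelEquiv (n : ℕ) (R : Type u) [CommRing R] :
    {x : UpperPos n ⊕ Unit → R // (upper (x ∘ Sum.inl)).det * x (Sum.inr ()) = 1} ≃
      borelSubgroup n R where
  toFun x := ⟨Matrix.GeneralLinearGroup.mk'' (upper (x.1 ∘ Sum.inl)) (.of_mul_eq_one _ x.2),
    fun i j h => by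
      change upper (x.1 ∘ Sum.inl) i j = 0
      simp [upper, h.not_ge]⟩
  invFun M := ⟨Sum.elim (fun p => (M : GL (Fin n) R) p.1.1 p.1.2)
      fun _ => ((Matrix.GeneralLinearGroup.det (M : GL (Fin n) R))⁻¹ : Rˣ), by
    have h : upper (fun p : UpperPos n => (M : GL (Fin n) R) p.1.1 p.1.2) =
        ((M : GL (Fin n) R) : Matrix (Fin n) (Fin n) R) := by
      ext i j
      by_cases hij : i ≤ j
      · simp [upper, hij]
      · simp [upper, hij, M.2 i j (not_le.1 hij)]
    simp only [Sum.elim_comp_inl, Sum.elim_inr, h]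
    exact (Matrix.GeneralLinearGroup.det (M : GL (Fin n) R)).mul_inv⟩
  left_inv x := by
    refine Subtype.ext (funext fun s => ?_)
    rcases s with s | s
    · change upper (x.1 ∘ Sum.inl) s.1.1 s.1.2 = _
      simp [upper, s.2]
    · exact Units.inv_eq_of_mul_eq_one_right x.2
  right_inv M := by
    refine Subtype.ext (Units.ext (Matrix.ext fun i j => ?_))
    change upper _ i j = (M : GL (Fin n) R) i j
    by_cases hij : i ≤ j
    · simp [upper, hij]
    · simp [upper, hij, M.2 i j (not_le.1 hij)]

/-- Diagonal entries of triangular matrices multiply entrywise in a commutative ring, so the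
diagonal of the commutator vanishes and gives no equation. -/
theorem borel_commute_iff {R : Type u} [CommRing R] (M N : borelSubgroup n R) :
    M * N = N * M ↔ ∀ p : {p : Fin n × Fin n // p.1 < p.2},
      ((M : GL (Fin n) R) * (N : GL (Fin n) R) - (N : GL (Fin n) R) * (M : GL (Fin n) R) :
        Matrix (Fin n) (Fin n) R) p.1.1 p.1.2 = 0 := by
  constructor
  · intro h p
    have h' : ((M : GL (Fin n) R) * (N : GL (Fin n) R) : Matrix (Fin n) (Fin n) R) =
        (N : GL (Fin n) R) * (M : GL (Fin n) R) :=
      congrArg (fun L : borelSubgroup n R => ((L : GL (Fin n) R) : Matrix (Fin n) (Fin n) R)) h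
    rw [h', sub_self, Matrix.zero_apply]
  · intro h
    refine Subtype.ext (Units.ext (Matrix.ext fun i j => ?_))
    rcases lt_trichotomy i j with hij | rfl | hij
    · exact sub_eq_zero.1 (h ⟨(i, j), hij⟩)
    · exact (borel_mul_diag n R M.2 N.2 i).trans
        ((mul_comm _ _).trans (borel_mul_diag n R N.2 M.2 i).symm)
    · exact ((M * N).2 i j hij).trans ((N * M).2 i j hij).symm

/-- In `hd`, each matrix has one extra variable, the inverse determinant, and one extra equation
defining it; these cancel in the dimension. -/
theorem isCompleteIntersection_borel (k : Type u) [Field k] (n d : ℕ)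
    (hd : d + (2 + Fintype.card {p : Fin n × Fin n // p.1 < p.2}) =
      2 * (Fintype.card (UpperPos n) + 1))
    (h : ∀ (K : Type u) [Field K] [Algebra k K] (x y : UpperPos n → K),
      (∀ p : {p : Fin n × Fin n // p.1 < p.2},
        (upper x * upper y - upper y * upper x) p.1.1 p.1.2 = 0) →
      IsParametrized k (Set.range fun s => (x s, y s)) d) :
    IsCompleteIntersection (commutingVariety (borel k n)) := by
  refine isCompleteIntersection_commutingVariety (borel k n) (borelRelation k n)
    (fun R => (Equiv.subtypeEquivRight fun x => by
      simp only [aeval_borelRelation, forall_const]).trans (borelEquiv n R)) ?_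
    (borelCommutator k n) ?_ d (by simpa using hd) ?_
  · intro R S φ x y hxy
    refine Subtype.ext (Units.ext (Matrix.ext fun i j => ?_))
    change upper (y.1 ∘ Sum.inl) i j = φ.hom (upper (x.1 ∘ Sum.inl) i j)
    by_cases hij : i ≤ j
    · simp [upper, hij, hxy]
    · simp [upper, hij]
  · intro R x y
    simp only [aeval_borelCommutator]
    have hz (z : {z : UpperPos n ⊕ Unit → R // ∀ i, aeval z (borelRelation k n i) = 0}) :
        (upper (z.1 ∘ Sum.inl)).det * z.1 (Sum.inr ()) = 1 :=
      (aeval_borelRelation z.1 ()).1 (z.2 ())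
    exact (borel_commute_iff (borelEquiv n R ⟨x.1, hz x⟩) (borelEquiv n R ⟨y.1, hz y⟩)).symm
  · intro K _ _ x y hx hy hxy
    simp only [aeval_borelCommutator] at hxy
    simp only [aeval_borelRelation, forall_const, det_upper, Function.comp_apply] at hx hy
    obtain ⟨T, hT, hm⟩ := h K _ _ hxy
    have hX : ∀ s, x (Sum.inl s) ∈ IntermediateField.adjoin k (T : Set K) :=
      fun s => (hm _ ⟨s, rfl⟩).1
    have hY : ∀ s, y (Sum.inl s) ∈ IntermediateField.adjoin k (T : Set K) :=
      fun s => (hm _ ⟨s, rfl⟩).2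
    refine ⟨T, hT, ?_, ?_⟩
    · rintro (s | s)
      · exact hX s
      -- The inverse determinant is a rational function of the diagonal entries and costs no
      -- parameter.
      · rw [eq_inv_of_mul_eq_one_right hx]
        exact inv_mem (prod_mem fun i _ => hX _)
    · rintro (s | s)
      · exact hY s
      · rw [eq_inv_of_mul_eq_one_right hy]
        exact inv_mem (prod_mem fun i _ => hY _)

/-- The point of the plane formed by the entries of two matrices in a given position. -/
def upperEntryPair (x y : UpperPos n → R) (i j : Fin n) (h : i ≤ j := by decide) : R × R :=
  (x ⟨(i, j), h⟩, y ⟨(i, j), h⟩)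

theorem isCompleteIntersection_borel_two (k : Type u) [Field k] :
    IsCompleteIntersection (commutingVariety (borel k 2)) := by
  refine isCompleteIntersection_borel k 2 5 (by decide) fun K _ _ x y hxy =>
    (isParametrized_borel_two (t₁ := upperEntryPair x y 0 0) (t₂ := upperEntryPair x y 1 1)
      (u := upperEntryPair x y 0 1) ?_).mono ?_ le_rfl
  · have h := hxy ⟨(0, 1), by decide⟩
    simp [Matrix.mul_apply, Fin.sum_univ_succ, upper] at h
    simp only [cross, upperEntryPair, Prod.fst_sub, Prod.snd_sub]
    linear_combination h
  · rintro _ ⟨⟨⟨i, j⟩, h⟩, rfl⟩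
    fin_cases i <;> fin_cases j <;> first | exact absurd h (by decide) | simp [upperEntryPair]

theorem isCompleteIntersection_borel_three (k : Type u) [Field k] :
    IsCompleteIntersection (commutingVariety (borel k 3)) := by
  refine isCompleteIntersection_borel k 3 9 (by decide) fun K _ _ x y hxy =>
    (isParametrized_borel_three (t₁ := upperEntryPair x y 0 0) (t₂ := upperEntryPair x y 1 1)
      (t₃ := upperEntryPair x y 2 2) (u₁ := upperEntryPair x y 0 1)
      (u₂ := upperEntryPair x y 1 2) (v := upperEntryPair x y 0 2) ?_ ?_ ?_).mono ?_ le_rfl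
  · have h := hxy ⟨(0, 1), by decide⟩
    simp [Matrix.mul_apply, Fin.sum_univ_succ, upper] at h
    simp only [cross, upperEntryPair, Prod.fst_sub, Prod.snd_sub]
    linear_combination h
  · have h := hxy ⟨(1, 2), by decide⟩
    simp [Matrix.mul_apply, Fin.sum_univ_succ, upper] at h
    simp only [cross, upperEntryPair, Prod.fst_sub, Prod.snd_sub]
    linear_combination h
  · have h := hxy ⟨(0, 2), by decide⟩
    simp [Matrix.mul_apply, Fin.sum_univ_succ, upper] at h
    simp only [cross, upperEntryPair, Prod.fst_sub, Prod.snd_sub]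
    linear_combination h
  · rintro _ ⟨⟨⟨i, j⟩, h⟩, rfl⟩
    fin_cases i <;> fin_cases j <;> first | exact absurd h (by decide) | simp [upperEntryPair]

end Borel

end CommVar

theorem mainTheorem4 (k : Type u) [Field k] [CharZero k] :
    CommVar.IsCompleteIntersection (CommVar.commutingVariety (CommVar.unipotent k 2)) ∧
    CommVar.IsCompleteIntersection (CommVar.commutingVariety (CommVar.unipotent k 3)) ∧
    CommVar.IsCompleteIntersection (CommVar.commutingVariety (CommVar.unipotent k 4)) ∧
    CommVar.IsCompleteIntersection (CommVar.commutingVariety (CommVar.unipotent k 5)) ∧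
    CommVar.IsCompleteIntersection (CommVar.commutingVariety (CommVar.borel k 2)) ∧
    CommVar.IsCompleteIntersection (CommVar.commutingVariety (CommVar.borel k 3)) :=
  ⟨CommVar.isCompleteIntersection_unipotent_two k, CommVar.isCompleteIntersection_unipotent_three k,
    CommVar.isCompleteIntersection_unipotent_four k, CommVar.isCompleteIntersection_unipotent_five k,
    CommVar.isCompleteIntersection_borel_two k, CommVar.isCompleteIntersection_borel_three k⟩
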